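/- \textbf{RLC gossip spreads $n$ files to $n$ nodes in $O(n)$ slots and achieves $O(n)$ age.} \emph{Protocol.} There are $n\ge 2$ nodes and $n$ files; node $f$ is the source of file $f$. Time is slotted, and $\mathbb F_q$ is a finite field with $q\ge n$. A coded packet is a linear combination over $\mathbb F_q$ of the $n$ files, together with its coefficient vector in $\mathbb F_q^n$. A dissemination starts with each node $i$ having only its own file $i$, uncoded. In every slot each node chooses a target uniformly at random among the other $n-1$ nodes. In RLC with PUSH each node sends to its target, and in RLC with PULL each node receives from its target, a linear combination of all coded packets that the sender has at the beginning of the slot, with coefficients uniform in $\mathbb F_q$. All targets and, for each transmission, all coefficients are independent. A node has \emph{received} file $f$ when its packets determine file $f$; in particular it has received all files as soon as it has $n$ linearly independent packets. \emph{Age.} Let $N^f_t$ be the version of file $f$ at its source in slot $t$: an arbitrary random process, possibly dependent on the gossip, in which each source gets at most one new version per slot. For $c\in\mathbb N$, $c\ge1$, split time into cycles of $cn$ slots. In cycle $k$ a new dissemination is run for the versions $N^f_{kcn}$, all packets of earlier cycles being withdrawn from transmission. Let $N^{if}_t$ be the latest version of file $f$ that node $i$ has at time $t$ (with $N^{if}_0=N^f_0$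 for all $i$, and $N^{ff}_t=N^f_t$ for all $t$), and let $X^{if}_t=N^f_t-N^{if}_t$ be the version age of file $f$ at node $i$. \emph{Statement.} For each of the two protocols, PUSH and PULL, there is an integer $c\ge 1$ such that the following hold. \begin{enumerate} \item There is a constant $K$ such that for all $n\ge2$ and all $\mathbb F_q$ with $q\ge n$, with probability at least $1-K/n$ every node has received all $n$ files after $cn$ slots of a dissemination. \item There are $p\in[0,1)$ and $n_0\in\mathbb N$ such that for all $n>n_0$, all $\mathbb F_q$ with $q\ge n$ and every node $i$, the probability that node $i$ has received all $n$ files after $cn$ slots of a dissemination is greater than $1-p$. \item There are a constant $A$ and $n_0\in\mathbb N$ such that for all $n>n_0$, all $\mathbb F_q$ with $q\ge n$, all update processes as above, all nodes $i$, all files $f$ and all times $t$, with cycles of $cn$ slots, $X^{if}_t$ is integrable and $\mathbb E[X^{if}_t]\le A\,n$. \end{enumerate} -/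

import Mathlib

open MeasureTheory ProbabilityTheory

universe u v

/-- The two variants of random linear coding (RLC) gossip. -/
inductive RLCMode where
  | push
  | pull

/-- The random choice made on behalf of node `i` in one time slot: a target among the *other*
nodes, and one coefficient for every potential coded packet. A coded packet is identified with its
coefficient vector in `F ^ n`; the combination formed uses only the coefficients of the packets
that the sender has. -/
structure RLCChoice (n : ℕ) (F : Type*) (i : Fin n) where
  target : Fin n
  target_ne : target ≠ i
  coeff : (Fin n → F) → F

instance {n : ℕ} {F : Type*} {i : Fin n} : MeasurableSpace (RLCChoice n F i) := ⊤

/-- The choices `ξ t i` (slot `t`, node `i`) are independent over all slots and nodes, and each is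
uniform: the target is uniform over the other nodes, and independently of it the coefficients are
independent and uniform in `F`. -/
structure IsRLCRandomness {n : ℕ} {F Ω : Type*} [MeasurableSpace Ω] (μ : Measure Ω)
    (ξ : ℕ → ∀ i : Fin n, Ω → RLCChoice n F i) : Prop where
  measurable : ∀ t i, Measurable (ξ t i)
  indep : iIndepFun (fun p : ℕ × Fin n => ξ p.1 p.2) μ
  uniform : ∀ t i, μ.map (ξ t i) = uniformOn Set.univ

section Protocol

variable {n : ℕ} {F : Type*} [Field F]

/-- The linear combination, with coefficients `β`, of all coded packets in `S`. -/
def codedPacket (S : Finset (Fin n → F)) (β : (Fin n → F) → F) : Fin n → F :=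
  ∑ a ∈ S, β a • a

open scoped Classical in
/-- One time slot of RLC gossip. `S i` is the set of coded packets that node `i` has at the
beginning of the slot, and `w i` is the choice made on behalf of node `i`.
PUSH: every node `j` sends a random combination of its packets to its target.
PULL: every node `i` gets a random combination of the packets of its target. -/
noncomputable def rlcStep (mode : RLCMode) (w : ∀ i : Fin n, RLCChoice n F i)
    (S : Fin n → Finset (Fin n → F)) : Fin n → Finset (Fin n → F) :=
  match mode with
  | .push => fun i => S i ∪
      (Finset.univ.filter fun j => (w j).target = i).image fun j => codedPacket (S j) (w j).coeff
  | .pull => fun i => insert (codedPacket (S (w i).target) (w i).coeff) (S i)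

/-- The packets of the nodes after a number of slots of a dissemination which starts with
node `i` having only its own file, uncoded, and which uses the choices `w 0, w 1, …`. -/
noncomputable def rlcState (mode : RLCMode) (w : ℕ → ∀ i : Fin n, RLCChoice n F i) :
    ℕ → Fin n → Finset (Fin n → F)
  | 0 => fun i => {Pi.single i 1}
  | s + 1 => rlcStep mode (w s) (rlcState mode w s)

/-- The coded packets in `S` determine file `f`: two assignments `x`, `y` of contents to the `n`
files for which all packets of `S` have the same payload agree on file `f`.
(Files are strings of symbols of `F` coded symbol by symbol, so one symbol per file suffices.) -/
def Decodes (S : Finset (Fin n → F)) (f : Fin n) : Prop :=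
  ∀ x y : Fin n → F, (∀ a ∈ S, ∑ j, a j * x j = ∑ j, a j * y j) → x f = y f

end Protocol

/-- `N f t` is the version of file `f` at its source, node `f`, in slot `t`: an arbitrary random
process in which every source gets at most one new version per slot. -/
structure IsUpdateProcess {n : ℕ} {Ω : Type*} [MeasurableSpace Ω]
    (N : Fin n → ℕ → Ω → ℕ) : Prop where
  measurable : ∀ f t, Measurable (N f t)
  mono : ∀ f t ω, N f t ω ≤ N f (t + 1) ω
  le_add_one : ∀ f t ω, N f (t + 1) ω ≤ N f t ω + 1

section Age

variable {n : ℕ} {F : Type*} [Field F]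

open scoped Classical in
/-- The version of file `f` held by a node `i ≠ f` at the beginning of cycle `k`. Cycles have `L`
slots. In cycle `k` a new dissemination takes place, in which file `f` is version `v f (k * L)`;
packets of earlier cycles are no longer sent. All nodes start with version `v f 0`. -/
noncomputable def versionAtCycle (mode : RLCMode) (L : ℕ)
    (w : ℕ → ∀ i : Fin n, RLCChoice n F i) (v : Fin n → ℕ → ℕ) (i f : Fin n) : ℕ → ℕ
  | 0 => v f 0
  | k + 1 => if Decodes (rlcState mode (fun s => w (k * L + s)) L i) f then v f (k * L)
      else versionAtCycle mode L w v i f k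

open scoped Classical in
/-- The latest version of file `f` available at node `i` at time `t`. The source always has the
current version; another node has the version of the cycle `t / L` that is under way if it has
already decoded it, and otherwise the version it had at the beginning of the cycle. -/
noncomputable def versionAt (mode : RLCMode) (L : ℕ)
    (w : ℕ → ∀ i : Fin n, RLCChoice n F i) (v : Fin n → ℕ → ℕ) (i f : Fin n) (t : ℕ) : ℕ :=
  if i = f then v f t
  else if Decodes (rlcState mode (fun s => w (t / L * L + s)) (t % L) i) f then v f (t / L * L)
  else versionAtCycle mode L w v i f (t / L)

/-- The version age of file `f` at node `i` at time `t`. -/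
noncomputable def versionAge (mode : RLCMode) (L : ℕ)
    (w : ℕ → ∀ i : Fin n, RLCChoice n F i) (v : Fin n → ℕ → ℕ) (i f : Fin n) (t : ℕ) : ℝ :=
  (v f t : ℝ) - (versionAt mode L w v i f t : ℝ)

end Age

/-!
A node can decode all files as soon as, for every nonzero vector `m`, it has a packet that is not
orthogonal to `m`. For a fixed `m`, having such a packet spreads like a rumor: if the sender has
one, the packet it sends is not orthogonal to `m` except with probability at most `1 / q`, where
`q = |F|`. There are up to `q ^ n` vectors `m`, and the targets alone make the rumor fail with
probability exponentially small in `n`, which does not beat `q ^ n` when `q ≥ n`. So the union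
bound over `m` must not be charged for the randomness of the targets, and the failure event is
covered by two kinds of events.

For a set `B` of nodes, initially a single node, a slot is a *trial* if some transmission leaves
`B`; one such transmission is singled out by means of the targets only, and its receiver joins `B`
if it is a success.

* `measureReal_few_trials_le` concerns the targets only. In every slot some transmission leaves
  `B ≠ ∅, univ` with probability at least `1 / 2` (`two_mul_card_crossing_eq_none_le`). Following
  *all* patterns of successes and failures at once, where each trial has two outcomes, the weight
  `4 ^ (-trials)` summed over the outcomes shrinks on average by `3 / 4` per slot. Hence after
  `30 n` slots, with high probability, no pattern at all has left fewer than `4 n` trials and an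
  incomplete set `B`.
* `measureReal_trials_fail_le` concerns one `m`. Since a success adds an element to `B`, an
  incomplete `B` after `4 n` trials means more than `3 n` failures, each of probability at most
  `1 / q` (`card_mul_card_crossingFails_le`). The supermartingale `(q / 2) ^ trials * q ^ (1 - |B|)`
  bounds the probability of this by `q ^ n * (2 / q) ^ (4 n)`, which survives the union bound over
  `q ^ n` vectors `m`.

Together they give `measureReal_not_decodes_le_div`: decoding fails with probability at most
`8 / n` after `30 n` slots.

For the version age, let `L = 30 n`. Versions grow by at most one per slot, so whatever the update
process, the age at the beginning of cycle `k` is at most `d k`, where `d (k + 1) = L` if the node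
decodes in cycle `k` and `d (k + 1) = L + d k` otherwise. This bound is a function of the gossip
alone, cycles are independent, and decoding fails with probability at most `1 / 2`, so that the
expectation of `d k` is at most `2 L`. Within a cycle the age grows by at most another `L`.

All probabilities are computed by counting: the choices in finitely many slots are uniform on a
finite product (`IsRLCRandomness.integral_sample`), and a potential which changes on average at
most by a constant factor under one uniform input is controlled by `sum_drive_le`.
-/

/-! ### Processes driven by independent uniform inputs -/

section Drive

variable {V E : Type*}

/-- The state reached from `x` by the inputs `g 0, …, g (T - 1)`, fed one after the other to
`step`. -/
def drive (step : V → E → E) (x : E) : (T : ℕ) → (Fin T → V) → E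
  | 0, _ => x
  | T + 1, g => step (g (Fin.last T)) (drive step x T (Fin.init g))

theorem drive_succ (step : V → E → E) (x : E) (T : ℕ) (w : ℕ → V) :
    drive step x (T + 1) (fun k => w k) = step (w T) (drive step x T fun k => w k) :=
  rfl

theorem drive_induction {step : V → E → E} {x : E} {p : E → Prop} (hx : p x)
    (hstep : ∀ v y, p y → p (step v y)) : ∀ (T : ℕ) (g : Fin T → V), p (drive step x T g)
  | 0, _ => hx
  | T + 1, g => hstep _ _ (drive_induction hx hstep T (Fin.init g))

variable [Fintype V]

theorem sum_drive_succ (step : V → E → E) (x : E) (φ : E → ℝ) (T : ℕ) :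
    ∑ g : Fin (T + 1) → V, φ (drive step x (T + 1) g) =
      ∑ g : Fin T → V, ∑ v, φ (step v (drive step x T g)) := by
  rw [← (Fin.snocEquiv fun _ : Fin (T + 1) => V).sum_comp, Fintype.sum_prod_type_right]
  simp [drive, Fin.snocEquiv]

/-- A potential whose average over one input grows at most by the factor `r` in each step has
after `T` steps grown on average at most by the factor `r ^ T`. -/
theorem sum_drive_le {step : V → E → E} {x : E} {p : E → Prop} (hx : p x)
    (hstep : ∀ v y, p y → p (step v y)) {φ : E → ℝ} {r : ℝ} (hr : 0 ≤ r)
    (hφ : ∀ y, p y → ∑ v, φ (step v y) ≤ Fintype.card V * (r * φ y)) (T : ℕ) :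
    ∑ g : Fin T → V, φ (drive step x T g) ≤ (Fintype.card V : ℝ) ^ T * (r ^ T * φ x) := by
  induction T with
  | zero => simp [drive]
  | succ T ih =>
    rw [sum_drive_succ]
    calc ∑ g : Fin T → V, ∑ v, φ (step v (drive step x T g))
        ≤ ∑ g : Fin T → V, Fintype.card V * (r * φ (drive step x T g)) :=
          Finset.sum_le_sum fun g _ => hφ _ (drive_induction hx hstep T g)
      _ = Fintype.card V * (r * ∑ g : Fin T → V, φ (drive step x T g)) := by
          simp only [Finset.mul_sum]
      _ ≤ Fintype.card V * (r * ((Fintype.card V : ℝ) ^ T * (r ^ T * φ x))) := by gcongr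
      _ = _ := by ring

end Drive

section Uniform

variable {Ω V E : Type*} [MeasurableSpace Ω] {μ : Measure Ω} [Fintype V] [MeasurableSpace V]
  {Y : ℕ → Ω → V}

/-- The random variables `Y 0, Y 1, …` with values in the finite type `V` are independent and
uniform: expectations of functions of `Y 0, …, Y (T - 1)` are averages over `V ^ T`. -/
structure IsUniformSequence (μ : Measure Ω) (Y : ℕ → Ω → V) : Prop where
  measurable : ∀ k, Measurable (Y k)
  integral_eq : ∀ (T : ℕ) (f : (Fin T → V) → ℝ),
    ∫ ω, f (fun k => Y k ω) ∂μ = (∑ g, f g) / (Fintype.card V : ℝ) ^ T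

namespace IsUniformSequence

theorem measurable_comp [DiscreteMeasurableSpace V] (hY : IsUniformSequence μ Y) {β : Type*}
    [MeasurableSpace β] (T : ℕ) (f : (Fin T → V) → β) : Measurable fun ω => f fun k => Y k ω :=
  (measurable_of_countable f).comp (measurable_pi_lambda _ fun k => hY.measurable k)

theorem card_pos [NeZero μ] (_hY : IsUniformSequence μ Y) : (0 : ℝ) < Fintype.card V := by
  obtain ⟨ω⟩ : Nonempty Ω := by
    by_contra h
    rw [not_nonempty_iff] at h
    exact NeZero.ne μ μ.eq_zero_of_isEmpty
  exact_mod_cast Fintype.card_pos_iff.2 ⟨Y 0 ω⟩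

theorem integral_drive_le [NeZero μ] (hY : IsUniformSequence μ Y) {step : V → E → E} {x : E}
    {p : E → Prop} (hx : p x) (hstep : ∀ v y, p y → p (step v y)) {φ : E → ℝ} {r : ℝ}
    (hr : 0 ≤ r) (hφ : ∀ y, p y → ∑ v, φ (step v y) ≤ Fintype.card V * (r * φ y)) (T : ℕ) :
    ∫ ω, φ (drive step x T fun k => Y k ω) ∂μ ≤ r ^ T * φ x := by
  rw [hY.integral_eq T fun g => φ (drive step x T g), div_le_iff₀' (pow_pos hY.card_pos T)]
  exact sum_drive_le hx hstep hr hφ T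

theorem integrable_comp [DiscreteMeasurableSpace V] [IsFiniteMeasure μ]
    (hY : IsUniformSequence μ Y) (T : ℕ) (f : (Fin T → V) → ℝ) :
    Integrable (fun ω => f fun k => Y k ω) μ :=
  .of_bound (hY.measurable_comp T f).aestronglyMeasurable (∑ g, ‖f g‖) <| .of_forall fun _ =>
    Finset.single_le_sum (f := fun g => ‖f g‖) (fun _ _ => norm_nonneg _) (Finset.mem_univ _)

theorem measurableSet_comp [DiscreteMeasurableSpace V] (hY : IsUniformSequence μ Y) (T : ℕ)
    (q : (Fin T → V) → Prop) : MeasurableSet {ω | q fun k => Y k ω} := by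
  simpa using hY.measurable_comp T q (measurableSet_singleton True)

theorem measureReal_eq_sum [DiscreteMeasurableSpace V] (hY : IsUniformSequence μ Y) (T : ℕ)
    (q : (Fin T → V) → Prop) [DecidablePred q] :
    μ.real {ω | q fun k => Y k ω} = (∑ g, if q g then 1 else 0) / (Fintype.card V : ℝ) ^ T := by
  rw [← integral_indicator_one (hY.measurableSet_comp T q), ← hY.integral_eq T]
  exact integral_congr_ae (.of_forall fun ω => by simp [Set.indicator_apply])

/-- Markov's inequality for a potential as in `integral_drive_le`. -/
theorem measureReal_drive_le [NeZero μ] [DiscreteMeasurableSpace V] (hY : IsUniformSequence μ Y)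
    {step : V → E → E} {x : E}
    {p : E → Prop} (hx : p x) (hstep : ∀ v y, p y → p (step v y)) {φ : E → ℝ} {r : ℝ}
    (hr : 0 ≤ r) (hφ : ∀ y, p y → ∑ v, φ (step v y) ≤ Fintype.card V * (r * φ y))
    (hφ0 : ∀ y, 0 ≤ φ y) {q : E → Prop} {a : ℝ} (ha : 0 < a) (hq : ∀ y, p y → q y → a ≤ φ y)
    (T : ℕ) :
    μ.real {ω | q (drive step x T fun k => Y k ω)} ≤ r ^ T * φ x / a := by
  classical
  have hpos := pow_pos hY.card_pos T
  rw [hY.measureReal_eq_sum T fun g => q (drive step x T g), div_le_div_iff₀ hpos ha]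
  calc (∑ g : Fin T → V, if q (drive step x T g) then (1 : ℝ) else 0) * a
      ≤ ∑ g : Fin T → V, φ (drive step x T g) := by
        rw [Finset.sum_mul]
        refine Finset.sum_le_sum fun g _ => ?_
        split_ifs with h
        · simpa using hq _ (drive_induction hx hstep T g) h
        · simpa using hφ0 _
    _ ≤ _ := sum_drive_le hx hstep hr hφ T
    _ = _ := by ring

end IsUniformSequence

end Uniform

/-! ### The choices of all nodes in one slot -/

section Slot

variable {n : ℕ} {F : Type*}

/-- The choices made on behalf of all nodes in one slot. -/
abbrev RLCSlot (n : ℕ) (F : Type*) : Type _ := ∀ i : Fin n, RLCChoice n F i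

/-- A choice is a target together with a family of coefficients. -/
def RLCChoice.equivProd (i : Fin n) :
    RLCChoice n F i ≃ {j : Fin n // j ≠ i} × ((Fin n → F) → F) where
  toFun c := (⟨c.target, c.target_ne⟩, c.coeff)
  invFun x := ⟨x.1, x.1.2, x.2⟩
  left_inv _ := rfl
  right_inv _ := rfl

noncomputable instance [Fintype F] {i : Fin n} : Fintype (RLCChoice n F i) := by
  classical exact Fintype.ofEquiv _ (RLCChoice.equivProd i).symm

instance {i : Fin n} : DiscreteMeasurableSpace (RLCChoice n F i) := ⟨fun _ => trivial⟩

theorem IsRLCRandomness.shift {Ω : Type*} [MeasurableSpace Ω] {μ : Measure Ω}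
    {ξ : ℕ → ∀ i : Fin n, Ω → RLCChoice n F i} (hξ : IsRLCRandomness μ ξ)
    (a : ℕ) : IsRLCRandomness μ fun s => ξ (a + s) where
  measurable t := hξ.measurable (a + t)
  indep := hξ.indep.precomp (g := fun p : ℕ × Fin n => (a + p.1, p.2)) fun p p' h => by
    simp only [Prod.mk.injEq, add_right_inj] at h
    exact Prod.ext h.1 h.2
  uniform t := hξ.uniform (a + t)

variable [Fintype F] {Ω : Type*} [MeasurableSpace Ω] {μ : Measure Ω}
  {ξ : ℕ → ∀ i : Fin n, Ω → RLCChoice n F i}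

namespace IsRLCRandomness

theorem measure_preimage_singleton (hξ : IsRLCRandomness μ ξ) (t : ℕ) (i : Fin n)
    (c : RLCChoice n F i) :
    μ (ξ t i ⁻¹' {c}) = (Fintype.card (RLCChoice n F i) : ENNReal)⁻¹ := by
  rw [← Measure.map_apply (hξ.measurable t i) (measurableSet_singleton c), hξ.uniform,
    uniformOn_univ, Measure.count_singleton, one_div]

/-- The choices in finitely many different slots are uniform on the product space. -/
theorem integral_sample (hξ : IsRLCRandomness μ ξ) [IsProbabilityMeasure μ] {ι : Type*}
    [Fintype ι] [DecidableEq ι] {e : ι → ℕ} (he : e.Injective) (f : (ι → RLCSlot n F) → ℝ) :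
    ∫ ω, f (fun k i => ξ (e k) i ω) ∂μ =
      (∑ g, f g) / (Fintype.card (RLCSlot n F) : ℝ) ^ Fintype.card ι := by
  have hmeas : Measurable fun ω (k : ι) (i : Fin n) => ξ (e k) i ω :=
    measurable_pi_lambda _ fun k => measurable_pi_lambda _ fun i => hξ.measurable _ _
  have hsing (g : ι → RLCSlot n F) : (μ.map fun ω (k : ι) (i : Fin n) => ξ (e k) i ω).real {g} =
      ((Fintype.card (RLCSlot n F) : ℝ) ^ Fintype.card ι)⁻¹ := by
    -- Independence is used for the choices in the slots `e k`, reindexed by `ι × Fin n`.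
    have hinj : Function.Injective fun p : ι × Fin n => (e p.1, p.2) := by
      rintro ⟨a, b⟩ ⟨a', b'⟩ h
      simp only [Prod.mk.injEq] at h
      exact Prod.ext (he h.1) h.2
    have h := (hξ.indep.precomp hinj).measure_inter_preimage_eq_mul Finset.univ
      (sets := fun p => {g p.1 p.2}) fun _ _ => measurableSet_singleton _
    have hset : (fun ω (k : ι) (i : Fin n) => ξ (e k) i ω) ⁻¹' {g} =
        ⋂ p ∈ (Finset.univ : Finset (ι × Fin n)), ξ (e p.1) p.2 ⁻¹' {g p.1 p.2} := by
      ext ω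
      simp [funext_iff]
    rw [measureReal_def, Measure.map_apply hmeas (measurableSet_singleton g), hset, h,
      ENNReal.toReal_prod]
    simp only [hξ.measure_preimage_singleton, ENNReal.toReal_inv, ENNReal.toReal_natCast]
    rw [Fintype.prod_prod_type]
    simp only [Finset.prod_inv_distrib, Fintype.card_pi, Nat.cast_prod]
    rw [← Finset.card_univ (α := ι), ← Finset.prod_const]
  have := Measure.isProbabilityMeasure_map (μ := μ) hmeas.aemeasurable
  rw [← integral_map (φ := fun ω (k : ι) (i : Fin n) => ξ (e k) i ω) hmeas.aemeasurable
    (measurable_of_countable f).aestronglyMeasurable, integral_fintype .of_finite]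
  simp only [hsing, smul_eq_mul, ← Finset.mul_sum]
  rw [div_eq_inv_mul]

theorem isUniformSequence (hξ : IsRLCRandomness μ ξ) [IsProbabilityMeasure μ] :
    IsUniformSequence μ fun t ω => (fun i => ξ t i ω : RLCSlot n F) where
  measurable t := measurable_pi_lambda _ fun i => hξ.measurable t i
  integral_eq T f := by simpa only [Fintype.card_fin] using hξ.integral_sample Fin.val_injective f

/-- The choices in the slots of a cycle, as one random variable for every cycle. -/
theorem isUniformSequence_cycle (hξ : IsRLCRandomness μ ξ) [IsProbabilityMeasure μ] (L : ℕ) :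
    IsUniformSequence μ fun k ω => (fun s i => ξ (k * L + s) i ω : Fin L → RLCSlot n F) where
  measurable k := measurable_pi_lambda _ fun s => measurable_pi_lambda _ fun i =>
    hξ.measurable _ i
  integral_eq T f := by
    have he : Function.Injective fun p : Fin T × Fin L => (p.1 * L + p.2 : ℕ) := by
      rintro ⟨a, b⟩ ⟨a', b'⟩ h
      have hL : 0 < L := b.pos
      have h1 := congrArg (· / L) h
      have h2 := congrArg (· % L) h
      simp only [Nat.mul_add_mod_of_lt b.2, Nat.mul_add_mod_of_lt b'.2] at h2
      simp only [Nat.mul_comm _ L, Nat.mul_add_div hL, Nat.div_eq_of_lt b.2,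
        Nat.div_eq_of_lt b'.2, add_zero] at h1
      exact Prod.ext (Fin.ext h1) (Fin.ext h2)
    have h := hξ.integral_sample he fun g => f fun k s => g (k, s)
    rw [h, Fintype.card_prod, Fintype.card_fin, Fintype.card_fin, Fintype.card_fun,
      Fintype.card_fin, Nat.cast_pow, ← pow_mul, mul_comm L T,
      ← (Equiv.curry (Fin T) (Fin L) (RLCSlot n F)).sum_comp]
    rfl

end IsRLCRandomness

end Slot

/-! ### Transmissions that leave a set of nodes -/

section Crossing

variable {n : ℕ} {F : Type*}

/-- The sender of the transmission that results from the choice of node `i`, if the nodes have the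
targets `τ`. -/
def RLCMode.sender (mode : RLCMode) (τ : Fin n → Fin n) (i : Fin n) : Fin n :=
  match mode with
  | .push => i
  | .pull => τ i

/-- The receiver of the transmission that results from the choice of node `i`, if the nodes have
the targets `τ`. -/
def RLCMode.receiver (mode : RLCMode) (τ : Fin n → Fin n) (i : Fin n) : Fin n :=
  match mode with
  | .push => τ i
  | .pull => i

/-- The targets in a slot. -/
def RLCSlot.targets (w : RLCSlot n F) : Fin n → Fin n := fun i => (w i).target

open scoped Classical in
/-- A node whose choice results in a transmission from `B` to the complement of `B`, if there is
one. It depends only on the targets, not on the coefficients. -/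
noncomputable def crossing (mode : RLCMode) (τ : Fin n → Fin n) (B : Finset (Fin n)) :
    Option (Fin n) :=
  if h : ∃ i, mode.sender τ i ∈ B ∧ mode.receiver τ i ∉ B then some h.choose else none

variable {mode : RLCMode} {τ : Fin n → Fin n} {B : Finset (Fin n)} {i : Fin n}

theorem crossing_spec (h : crossing mode τ B = some i) :
    mode.sender τ i ∈ B ∧ mode.receiver τ i ∉ B := by
  unfold crossing at h
  split_ifs at h with h'
  cases h
  exact h'.choose_spec

theorem crossing_eq_none :
    crossing mode τ B = none ↔ ∀ i, mode.sender τ i ∈ B → mode.receiver τ i ∈ B := by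
  simp [crossing]

/-- The nodes whose choices can result in a transmission from `B` to its complement: a choice
does so exactly if it is made for a node of this set and has its target outside this set. -/
def RLCMode.choosers (mode : RLCMode) (B : Finset (Fin n)) : Finset (Fin n) :=
  match mode with
  | .push => B
  | .pull => Bᶜ

theorem crossing_eq_none_iff_choosers :
    crossing mode τ B = none ↔ ∀ i ∈ mode.choosers B, τ i ∈ mode.choosers B := by
  rw [crossing_eq_none]
  cases mode with
  | push => rfl
  | pull => simp [RLCMode.sender, RLCMode.receiver, RLCMode.choosers, not_imp_not]

variable [Fintype F]

theorem card_filter_target (i : Fin n) (p : Fin n → Prop) [DecidablePred p] :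
    (Finset.univ.filter fun c : RLCChoice n F i => p c.target).card =
      (Finset.univ.filter fun j => j ≠ i ∧ p j).card * Nat.card ((Fin n → F) → F) := by
  let e : {c : RLCChoice n F i // p c.target} ≃ {j // j ≠ i ∧ p j} × ((Fin n → F) → F) :=
    { toFun := fun c => (⟨c.1.target, c.1.target_ne, c.2⟩, c.1.coeff)
      invFun := fun x => ⟨⟨x.1, x.1.2.1, x.2⟩, x.1.2.2⟩
      left_inv := fun _ => rfl
      right_inv := fun _ => rfl }
  rw [← Fintype.card_subtype, ← Fintype.card_subtype, ← Nat.card_eq_fintype_card,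
    ← Nat.card_eq_fintype_card, Nat.card_congr e, Nat.card_prod]

theorem two_mul_pred_pow_self_le {z N : ℕ} (hz : 0 < z) (hN : z ≤ N) :
    2 * (z - 1) ^ z ≤ N ^ z := by
  refine le_trans ?_ (Nat.pow_le_pow_left hN z)
  obtain ⟨y, rfl⟩ : ∃ y, z = y + 1 := ⟨z - 1, by lia⟩
  rcases Nat.eq_zero_or_pos y with rfl | hy
  · simp
  have hy' : (0 : ℚ) < y := by exact_mod_cast hy
  have hb := one_add_mul_le_pow (R := ℚ) (a := 1 / y)
    (le_trans (by norm_num) (one_div_pos.2 hy').le) (y + 1)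
  have h2 : (2 : ℚ) ≤ (1 + 1 / y) ^ (y + 1) := by
    refine le_trans ?_ hb
    push_cast
    field_simp
    linarith
  have h3 : (2 : ℚ) * y ^ (y + 1) ≤ (y + 1) ^ (y + 1) := by
    calc (2 : ℚ) * y ^ (y + 1) ≤ (1 + 1 / y) ^ (y + 1) * y ^ (y + 1) := by gcongr
      _ = (y + 1) ^ (y + 1) := by rw [← mul_pow]; field_simp
  simp only [Nat.add_sub_cancel]
  exact_mod_cast h3

open scoped Classical in
/-- With probability at least `1 / 2` some transmission of a slot leaves `B`: if `z` is the number
of choosers, then the probability that none does is `((z - 1) / (n - 1)) ^ z`, where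
`z ≤ n - 1`. -/
theorem two_mul_card_crossing_eq_none_le (mode : RLCMode) (hB : B.Nonempty)
    (hB' : B ≠ Finset.univ) :
    2 * (Finset.univ.filter fun w : RLCSlot n F => crossing mode w.targets B = none).card ≤
      Fintype.card (RLCSlot n F) := by
  set Z := mode.choosers B with hZ
  have hZ0 : 0 < Z.card := by
    rw [Finset.card_pos]
    cases mode with
    | push => exact hB
    | pull => simpa [hZ, RLCMode.choosers, Finset.nonempty_iff_ne_empty] using hB'
  have hZn : Z.card ≤ n - 1 := by
    have : Z.card < n := by
      conv_rhs => rw [← Fintype.card_fin n]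
      rw [Finset.card_lt_iff_ne_univ]
      cases mode with
      | push => exact hB'
      | pull =>
        intro h
        exact hB.ne_empty (by simpa [hZ, RLCMode.choosers, Finset.compl_eq_univ_iff] using h)
    lia
  set m := Nat.card ((Fin n → F) → F)
  have hset : (Finset.univ.filter fun w : RLCSlot n F => crossing mode w.targets B = none) =
      Fintype.piFinset fun i =>
        Finset.univ.filter fun c : RLCChoice n F i => i ∈ Z → c.target ∈ Z := by
    ext w
    simp [crossing_eq_none_iff_choosers, RLCSlot.targets, hZ]
  have htot (i : Fin n) : Fintype.card (RLCChoice n F i) = (n - 1) * m := by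
    have h := card_filter_target (F := F) i fun _ => True
    rw [Finset.filter_true] at h
    rw [← Finset.card_univ, h]
    simp [Finset.filter_ne', m]
  have hin (i : Fin n) (hi : i ∈ Z) :
      (Finset.univ.filter fun c : RLCChoice n F i => i ∈ Z → c.target ∈ Z).card =
        (Z.card - 1) * m := by
    have h := card_filter_target (F := F) i fun j => i ∈ Z → j ∈ Z
    rw [h, ← Finset.card_erase_of_mem hi]
    congr 2
    ext j
    simp [hi]
  have hout (i : Fin n) (hi : i ∈ Zᶜ) :
      (Finset.univ.filter fun c : RLCChoice n F i => i ∈ Z → c.target ∈ Z).card = (n - 1) * m := by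
    rw [Finset.mem_compl] at hi
    simp only [hi, false_imp_iff, Finset.filter_true, Finset.card_univ, htot]
  rw [hset, Fintype.card_piFinset, Fintype.card_pi, ← Finset.prod_mul_prod_compl Z,
    ← Finset.prod_mul_prod_compl Z, Finset.prod_congr rfl hin, Finset.prod_congr rfl hout,
    Finset.prod_congr rfl fun i (_ : i ∈ Z) => htot i,
    Finset.prod_congr rfl fun i (_ : i ∈ Zᶜ) => htot i]
  simp only [Finset.prod_const]
  rw [← mul_assoc, mul_pow, mul_pow _ m Z.card, ← mul_assoc]
  gcongr
  exact two_mul_pred_pow_self_le hZ0 hZn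

end Crossing

section Coefficients

variable {n : ℕ} {F : Type*} [Field F]

theorem codedPacket_dotProduct (S : Finset (Fin n → F)) (β : (Fin n → F) → F) (m : Fin n → F) :
    dotProduct (codedPacket S β) m = ∑ a ∈ S, β a * dotProduct a m := by
  simp [codedPacket, sum_dotProduct]

open scoped Classical in
/-- The slot `w` with `c` added to the coefficient of the packet `b` in the choice of node `i`. -/
noncomputable def RLCSlot.shift (w : RLCSlot n F) (i : Fin n) (b : Fin n → F) (c : F) :
    RLCSlot n F :=
  Function.update w i
    ⟨(w i).target, (w i).target_ne, Function.update (w i).coeff b ((w i).coeff b + c)⟩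

theorem RLCSlot.targets_shift (w : RLCSlot n F) (i : Fin n) (b : Fin n → F) (c : F) :
    (w.shift i b c).targets = w.targets := by
  funext j
  by_cases h : j = i
  · subst h
    simp [shift, targets]
  · simp [shift, targets, h]

theorem RLCSlot.shift_shift_neg (w : RLCSlot n F) (i : Fin n) (b : Fin n → F) (c : F) :
    (w.shift i b c).shift i b (-c) = w := by
  simp [shift]

theorem RLCSlot.codedPacket_shift_dotProduct (w : RLCSlot n F) (i : Fin n) {b : Fin n → F} (c : F)
    {S : Finset (Fin n → F)} (hb : b ∈ S) (m : Fin n → F) :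
    dotProduct (codedPacket S (w.shift i b c i).coeff) m =
      dotProduct (codedPacket S (w i).coeff) m + c * dotProduct b m := by
  classical
  rw [codedPacket_dotProduct, codedPacket_dotProduct, ← Finset.add_sum_erase _ _ hb,
    ← Finset.add_sum_erase S (fun a => (w i).coeff a * dotProduct a m) hb]
  have h : ∑ a ∈ S.erase b, (w.shift i b c i).coeff a * dotProduct a m =
      ∑ a ∈ S.erase b, (w i).coeff a * dotProduct a m :=
    Finset.sum_congr rfl fun a ha => by simp [shift, Finset.ne_of_mem_erase ha]
  rw [h]
  simp [shift]
  ring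

/-- The canonical transmission that leaves `B` carries a packet orthogonal to `m`. -/
def CrossingFails (mode : RLCMode) (m : Fin n → F) (S : Fin n → Finset (Fin n → F))
    (B : Finset (Fin n)) (w : RLCSlot n F) : Prop :=
  ∃ i, crossing mode w.targets B = some i ∧
    dotProduct (codedPacket (S (mode.sender w.targets i)) (w i).coeff) m = 0

open scoped Classical in
/-- If every node of `B` has a packet that is not orthogonal to `m`, then a transmission that
leaves `B` is orthogonal to `m` with probability at most `1 / |F|`: adding the elements of `F` to
the coefficient of one such packet makes `|F|` different slots out of each failing one. -/
theorem card_mul_card_crossingFails_le [Fintype F] (mode : RLCMode) {m : Fin n → F}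
    {S : Fin n → Finset (Fin n → F)} {B : Finset (Fin n)}
    (hS : ∀ i ∈ B, ∃ a ∈ S i, dotProduct a m ≠ 0) :
    Fintype.card F * (Finset.univ.filter (CrossingFails mode m S B)).card ≤
      (Finset.univ.filter fun w : RLCSlot n F => crossing mode w.targets B ≠ none).card := by
  choose! a haS ham using hS
  rw [← Finset.card_univ, ← Finset.card_product]
  let f : F × RLCSlot n F → RLCSlot n F := fun x =>
    match crossing mode x.2.targets B with
    | none => x.2
    | some i => x.2.shift i (a (mode.sender x.2.targets i)) x.1
  have hf {x : F × RLCSlot n F} {i : Fin n} (h : crossing mode x.2.targets B = some i) :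
      f x = x.2.shift i (a (mode.sender x.2.targets i)) x.1 := by
    simp only [f, h]
  refine Finset.card_le_card_of_injOn f ?_ ?_
  · rintro x hx
    obtain ⟨i, hi, -⟩ := (Finset.mem_filter.1 (Finset.mem_product.1 hx).2).2
    simp [hf hi, RLCSlot.targets_shift, hi]
  · rintro x hx y hy hxy
    obtain ⟨i, hi, hi0⟩ := (Finset.mem_filter.1 (Finset.mem_product.1 hx).2).2
    obtain ⟨j, hj, hj0⟩ := (Finset.mem_filter.1 (Finset.mem_product.1 hy).2).2
    rw [hf hi, hf hj] at hxy
    have ht : x.2.targets = y.2.targets := by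
      rw [← RLCSlot.targets_shift x.2, hxy, RLCSlot.targets_shift]
    obtain rfl : i = j := by
      rw [ht, hj] at hi
      exact (Option.some_injective _ hi).symm
    rw [ht] at hxy hi0
    have hs := (crossing_spec hj).1
    set s := mode.sender y.2.targets i
    have hdot : x.1 * dotProduct (a s) m = y.1 * dotProduct (a s) m := by
      have h := RLCSlot.codedPacket_shift_dotProduct x.2 i x.1 (haS s hs) m
      rw [hxy, RLCSlot.codedPacket_shift_dotProduct y.2 i y.1 (haS s hs) m, hi0, hj0] at h
      simpa using h.symm
    have h1 : x.1 = y.1 := mul_right_cancel₀ (ham s hs) hdot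
    refine Prod.ext h1 ?_
    rw [← RLCSlot.shift_shift_neg x.2 i (a s) x.1, hxy, h1, RLCSlot.shift_shift_neg]

end Coefficients

/-! ### The targets provide many trials -/

section Branching

variable {n : ℕ} {F : Type*}

/-- The outcomes of one slot with targets `w.targets`, for all pairs `(B, k)` in the list at once.
If some transmission leaves `B`, this is a trial, counted by `k`, and both outcomes are kept: the
failure, with the same set `B`, and the success, with the receiver added to `B`. -/
noncomputable def branchStep (mode : RLCMode) (w : RLCSlot n F)
    (X : List (Finset (Fin n) × ℕ)) : List (Finset (Fin n) × ℕ) :=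
  X.flatMap fun p =>
    match crossing mode w.targets p.1 with
    | none => [p]
    | some i => [(p.1, p.2 + 1), (insert (mode.receiver w.targets i) p.1, p.2 + 1)]

open scoped Classical in
/-- The weight of a pair `(B, k)`, which is zero if no transmission can leave `B`. A trial divides
the weight by four and has two outcomes, so that it halves the total weight at least. -/
noncomputable def branchWeight (p : Finset (Fin n) × ℕ) : ℝ :=
  if p.1 = ∅ ∨ p.1 = Finset.univ then 0 else (1 / 4) ^ p.2

/-- The sum of the weights of the pairs in a list. -/
noncomputable def branchPotential (X : List (Finset (Fin n) × ℕ)) : ℝ :=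
  (X.map branchWeight).sum

theorem branchWeight_nonneg (p : Finset (Fin n) × ℕ) : 0 ≤ branchWeight p := by
  unfold branchWeight
  split_ifs <;> positivity

theorem branchWeight_le (p : Finset (Fin n) × ℕ) : branchWeight p ≤ (1 / 4) ^ p.2 := by
  unfold branchWeight
  split_ifs
  · positivity
  · rfl

theorem branchPotential_nonneg (X : List (Finset (Fin n) × ℕ)) : 0 ≤ branchPotential X :=
  List.sum_nonneg fun x hx => by
    obtain ⟨p, -, rfl⟩ := List.mem_map.1 hx
    exact branchWeight_nonneg p

theorem branchWeight_le_branchPotential {X : List (Finset (Fin n) × ℕ)} {p : Finset (Fin n) × ℕ}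
    (hp : p ∈ X) : branchWeight p ≤ branchPotential X :=
  List.single_le_sum (fun x hx => by
    obtain ⟨p, -, rfl⟩ := List.mem_map.1 hx
    exact branchWeight_nonneg p) _ (List.mem_map_of_mem hp)

variable [Fintype F]

open scoped Classical in
theorem sum_branchPotential_singleton_le (mode : RLCMode) (p : Finset (Fin n) × ℕ) :
    ∑ w : RLCSlot n F, branchPotential (branchStep mode w [p]) ≤
      Fintype.card (RLCSlot n F) * (3 / 4 * branchWeight p) := by
  by_cases hp : p.1 = ∅ ∨ p.1 = Finset.univ
  · have hnone (w : RLCSlot n F) : crossing mode w.targets p.1 = none := by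
      rw [crossing_eq_none]
      rcases hp with hp | hp <;> simp [hp]
    simp [branchStep, branchPotential, hnone, branchWeight, hp]
  · push Not at hp
    have hw (w : RLCSlot n F) : branchPotential (branchStep mode w [p]) ≤
        branchWeight p * (1 / 2 + 1 / 2 * if crossing mode w.targets p.1 = none then 1 else 0) := by
      have h0 : branchWeight p = (1 / 4) ^ p.2 := if_neg (by simp [hp.1.ne_empty, hp.2])
      rcases h : crossing mode w.targets p.1 with _ | i
      · simp [branchStep, branchPotential, h]
        linarith
      · have h1 := branchWeight_le (p.1, p.2 + 1)
        have h2 := branchWeight_le (insert (mode.receiver w.targets i) p.1, p.2 + 1)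
        simp only [branchStep, branchPotential, h, List.flatMap_cons, List.flatMap_nil,
          List.append_nil, List.map_cons, List.map_nil, List.sum_cons, List.sum_nil, h0,
          pow_succ, reduceCtorEq, if_false] at h1 h2 ⊢
        linarith
    have hcard : 2 * ((Finset.univ.filter fun w : RLCSlot n F =>
        crossing mode w.targets p.1 = none).card : ℝ) ≤ Fintype.card (RLCSlot n F) := by
      exact_mod_cast two_mul_card_crossing_eq_none_le mode hp.1 hp.2
    calc _ ≤ _ := Finset.sum_le_sum fun w _ => hw w
      _ = branchWeight p * (Fintype.card (RLCSlot n F) * (1 / 2) +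
          1 / 2 * (Finset.univ.filter fun w : RLCSlot n F =>
            crossing mode w.targets p.1 = none).card) := by
        rw [← Finset.mul_sum, Finset.sum_add_distrib, ← Finset.mul_sum, Finset.sum_boole]
        simp
      _ ≤ branchWeight p * (Fintype.card (RLCSlot n F) * (3 / 4)) :=
        mul_le_mul_of_nonneg_left (by linarith) (branchWeight_nonneg p)
      _ = _ := by ring

theorem sum_branchPotential_le (mode : RLCMode) (X : List (Finset (Fin n) × ℕ)) :
    ∑ w : RLCSlot n F, branchPotential (branchStep mode w X) ≤
      Fintype.card (RLCSlot n F) * (3 / 4 * branchPotential X) := by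
  induction X with
  | nil => simp [branchStep, branchPotential]
  | cons p X ih =>
    have h1 (w : RLCSlot n F) : branchPotential (branchStep mode w (p :: X)) =
        branchPotential (branchStep mode w [p]) + branchPotential (branchStep mode w X) := by
      simp [branchPotential, branchStep]
    have h2 : branchPotential (p :: X) = branchWeight p + branchPotential X := by
      simp [branchPotential]
    simp only [h1, h2, Finset.sum_add_distrib, mul_add]
    exact add_le_add (sum_branchPotential_singleton_le mode p) ih

/-- The list of all single nodes, without trials. -/
noncomputable def singletonBranches (n : ℕ) : List (Finset (Fin n) × ℕ) :=
  Finset.univ.toList.map fun s => ({s}, 0)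

variable {Ω : Type*} [MeasurableSpace Ω] {μ : Measure Ω} [IsProbabilityMeasure μ]
  {Y : ℕ → Ω → RLCSlot n F}

/-- After `T` slots it is unlikely that some pattern of successes and failures leads from a single
node to a set other than that of all nodes in fewer than `M` trials. This concerns the targets
only, and holds for all patterns simultaneously. -/
theorem measureReal_few_trials_le (hY : IsUniformSequence μ Y) (mode : RLCMode) (T M : ℕ) :
    μ.real {ω | ∃ p ∈ drive (branchStep mode) (singletonBranches n) T fun t => Y t ω,
      p.1 ≠ ∅ ∧ p.1 ≠ Finset.univ ∧ p.2 < M} ≤ (3 / 4) ^ T * n / (1 / 4) ^ M := by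
  have h := hY.measureReal_drive_le (step := branchStep mode) (x := singletonBranches n)
    (p := fun _ => True) trivial (fun _ _ _ => trivial) (φ := branchPotential) (r := 3 / 4)
    (by norm_num) (fun X _ => sum_branchPotential_le mode X) branchPotential_nonneg
    (q := fun X => ∃ p ∈ X, p.1 ≠ ∅ ∧ p.1 ≠ Finset.univ ∧ p.2 < M) (a := (1 / 4) ^ M)
    (by positivity) ?_ T
  · refine h.trans ?_
    gcongr
    refine (List.sum_le_card_nsmul _ 1 fun x hx => ?_).trans_eq ?_
    · obtain ⟨p, hp, rfl⟩ := List.mem_map.1 hx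
      exact (branchWeight_le p).trans (pow_le_one₀ (by norm_num) (by norm_num))
    · simp [singletonBranches]
  · rintro X - ⟨p, hp, h0, h1, hM⟩
    refine le_trans ?_ (branchWeight_le_branchPotential hp)
    rw [branchWeight, if_neg (by simp [h0, h1])]
    exact pow_le_pow_of_le_one (by norm_num) (by norm_num) hM.le

end Branching

/-! ### Many trials inform all nodes about a vector -/

section Trials

variable {n : ℕ} {F : Type*} [Field F]

/-- The state of a dissemination together with a set `B` of nodes that are known to have packets
not orthogonal to a given vector `m`, and the number of trials so far. -/
abbrev TrialState (n : ℕ) (F : Type*) : Type _ :=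
  (Fin n → Finset (Fin n → F)) × Finset (Fin n) × ℕ

open scoped Classical in
/-- One slot of the dissemination. If some transmission leaves `B`, one such transmission is a
trial; it is a success if its packet is not orthogonal to `m`, and then the receiver joins `B`. -/
noncomputable def trialStep (mode : RLCMode) (m : Fin n → F) (w : RLCSlot n F)
    (x : TrialState n F) : TrialState n F :=
  (rlcStep mode w x.1,
    match crossing mode w.targets x.2.1 with
    | none => x.2
    | some i =>
      (if dotProduct (codedPacket (x.1 (mode.sender w.targets i)) (w i).coeff) m = 0 then x.2.1
        else insert (mode.receiver w.targets i) x.2.1, x.2.2 + 1))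

/-- The set `B` of a state is not empty, and its nodes have packets not orthogonal to `m`. -/
def TrialState.Valid (m : Fin n → F) (x : TrialState n F) : Prop :=
  x.2.1.Nonempty ∧ ∀ i ∈ x.2.1, ∃ a ∈ x.1 i, dotProduct a m ≠ 0

theorem subset_rlcStep (mode : RLCMode) (w : RLCSlot n F) (S : Fin n → Finset (Fin n → F))
    (i : Fin n) : S i ⊆ rlcStep mode w S i := by
  classical
  cases mode with
  | push => exact fun a ha => Finset.mem_union_left _ ha
  | pull => exact fun a ha => Finset.mem_insert_of_mem ha

theorem codedPacket_mem_rlcStep (mode : RLCMode) (w : RLCSlot n F)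
    (S : Fin n → Finset (Fin n → F)) (i : Fin n) :
    codedPacket (S (mode.sender w.targets i)) (w i).coeff ∈
      rlcStep mode w S (mode.receiver w.targets i) := by
  classical
  cases mode with
  | push =>
    exact Finset.mem_union_right _
      (Finset.mem_image.2 ⟨i, Finset.mem_filter.2 ⟨Finset.mem_univ i, rfl⟩, rfl⟩)
  | pull => exact Finset.mem_insert_self _ _

theorem TrialState.Valid.trialStep {mode : RLCMode} {m : Fin n → F} {x : TrialState n F}
    (w : RLCSlot n F) (hx : x.Valid m) : (trialStep mode m w x).Valid m := by
  classical
  have hold (j : Fin n) (hj : j ∈ x.2.1) : ∃ a ∈ rlcStep mode w x.1 j, dotProduct a m ≠ 0 := by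
    obtain ⟨a, ha, ham⟩ := hx.2 j hj
    exact ⟨a, subset_rlcStep mode w x.1 j ha, ham⟩
  unfold _root_.trialStep
  rcases crossing mode w.targets x.2.1 with _ | i
  · exact ⟨hx.1, hold⟩
  · by_cases h0 : dotProduct (codedPacket (x.1 (mode.sender w.targets i)) (w i).coeff) m = 0
    · simp only [h0, if_true]
      exact ⟨hx.1, hold⟩
    · simp only [h0, if_false]
      refine ⟨Finset.insert_nonempty _ _, fun j hj => ?_⟩
      rcases Finset.mem_insert.1 hj with rfl | hj
      · exact ⟨_, codedPacket_mem_rlcStep mode w x.1 i, h0⟩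
      · exact hold j hj

theorem trialStep_mem_branchStep {mode : RLCMode} (m : Fin n → F) (w : RLCSlot n F)
    {x : TrialState n F} {X : List (Finset (Fin n) × ℕ)} (hx : x.2 ∈ X) :
    (trialStep mode m w x).2 ∈ branchStep mode w X := by
  classical
  refine List.mem_flatMap.2 ⟨x.2, hx, ?_⟩
  unfold trialStep
  rcases crossing mode w.targets x.2.1 with _ | i
  · simp
  · simp only [List.mem_cons]
    split_ifs <;> simp

variable [Fintype F]

/-- With `q = |F|`, a failure multiplies this potential by `q / 2`, and a success, which adds an
element to `B`, divides it by two. As failures have probability at most `1 / q`, the potential is a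
supermartingale. -/
noncomputable def trialPotential (x : TrialState n F) : ℝ :=
  (Fintype.card F / 2 : ℝ) ^ x.2.2 * Fintype.card F / (Fintype.card F : ℝ) ^ x.2.1.card

theorem trialPotential_nonneg (x : TrialState n F) : 0 ≤ trialPotential x := by
  unfold trialPotential
  positivity

open scoped Classical in
theorem sum_trialPotential_le (mode : RLCMode) (m : Fin n → F) {x : TrialState n F}
    (hx : x.Valid m) :
    ∑ w, trialPotential (trialStep mode m w x) ≤
      Fintype.card (RLCSlot n F) * (1 * trialPotential x) := by
  have hq : (0 : ℝ) < Fintype.card F := by exact_mod_cast Fintype.card_pos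
  have hw (w : RLCSlot n F) : trialPotential (trialStep mode m w x) ≤
      trialPotential x * (1 + (Fintype.card F / 2 * (if CrossingFails mode m x.1 x.2.1 w then 1
        else 0) - 1 / 2 * if crossing mode w.targets x.2.1 ≠ none then 1 else 0)) := by
    rcases h : crossing mode w.targets x.2.1 with _ | i
    · simp [trialPotential, trialStep, CrossingFails, h]
    · by_cases h0 : dotProduct (codedPacket (x.1 (mode.sender w.targets i)) (w i).coeff) m = 0
      · have hval : trialPotential (trialStep mode m w x) =
            trialPotential x * (Fintype.card F / 2) := by
          simp only [trialPotential, trialStep, h, h0, if_true]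
          ring
        have hf : CrossingFails mode m x.1 x.2.1 w := ⟨i, h, h0⟩
        rw [hval]
        refine mul_le_mul_of_nonneg_left ?_ (trialPotential_nonneg x)
        simp only [hf, if_true, ne_eq, reduceCtorEq, not_false_eq_true]
        linarith
      · have hval : trialPotential (trialStep mode m w x) = trialPotential x * (1 / 2) := by
          simp only [trialPotential, trialStep, h, h0, if_false,
            Finset.card_insert_of_notMem (crossing_spec h).2]
          field_simp
          ring
        have hf : ¬ CrossingFails mode m x.1 x.2.1 w := by
          rintro ⟨j, hj, hj0⟩
          rw [h] at hj
          exact h0 (by rwa [← Option.some_injective _ hj] at hj0)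
        rw [hval]
        refine mul_le_mul_of_nonneg_left ?_ (trialPotential_nonneg x)
        simp only [hf, if_true, if_false, ne_eq, reduceCtorEq, not_false_eq_true]
        linarith
  have hcard : (Fintype.card F : ℝ) *
      (Finset.univ.filter (CrossingFails mode m x.1 x.2.1)).card ≤
      (Finset.univ.filter fun w : RLCSlot n F => crossing mode w.targets x.2.1 ≠ none).card := by
    exact_mod_cast card_mul_card_crossingFails_le mode hx.2
  calc _ ≤ _ := Finset.sum_le_sum fun w _ => hw w
    _ = trialPotential x * (Fintype.card (RLCSlot n F) +
        (Fintype.card F / 2 * (Finset.univ.filter (CrossingFails mode m x.1 x.2.1)).card -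
          1 / 2 * (Finset.univ.filter fun w : RLCSlot n F =>
            crossing mode w.targets x.2.1 ≠ none).card)) := by
      rw [← Finset.mul_sum, Finset.sum_add_distrib, Finset.sum_sub_distrib, ← Finset.mul_sum,
        ← Finset.mul_sum, Finset.sum_boole, Finset.sum_boole]
      simp
    _ ≤ trialPotential x * (Fintype.card (RLCSlot n F) + 0) :=
      mul_le_mul_of_nonneg_left (by linarith) (trialPotential_nonneg x)
    _ = _ := by ring

variable {Ω : Type*} [MeasurableSpace Ω] {μ : Measure Ω} [IsProbabilityMeasure μ]
  {Y : ℕ → Ω → RLCSlot n F}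

/-- It is unlikely that `M` trials do not suffice to inform all nodes. -/
theorem measureReal_trials_fail_le (hY : IsUniformSequence μ Y) (mode : RLCMode) {m : Fin n → F}
    {x : TrialState n F} (hx : x.Valid m) (hB : x.2.1.card = 1) (hk : x.2.2 = 0) (T M : ℕ) :
    μ.real {ω | (drive (trialStep mode m) x T fun t => Y t ω).2.1 ≠ Finset.univ ∧
      M ≤ (drive (trialStep mode m) x T fun t => Y t ω).2.2} ≤
      (Fintype.card F : ℝ) ^ n * (2 / Fintype.card F) ^ M := by
  have hq : (2 : ℝ) ≤ Fintype.card F := by exact_mod_cast Fintype.one_lt_card (α := F)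
  have h := hY.measureReal_drive_le (step := trialStep mode m) (x := x)
    (p := TrialState.Valid m) hx (fun w _ h => h.trialStep w) (φ := trialPotential) (r := 1)
    (by norm_num) (fun x hx => sum_trialPotential_le mode m hx) trialPotential_nonneg
    (q := fun x => x.2.1 ≠ Finset.univ ∧ M ≤ x.2.2)
    (a := (Fintype.card F / 2) ^ M / (Fintype.card F : ℝ) ^ n) (by positivity) ?_ T
  · refine h.trans_eq ?_
    have hx1 : trialPotential x = 1 := by
      rw [trialPotential, hB, hk]
      field_simp
    rw [hx1, one_pow, one_mul, one_div_div, div_pow, div_pow]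
    field_simp
  · rintro y - ⟨-, hM⟩
    unfold trialPotential
    have h1 : (Fintype.card F : ℝ) ^ y.2.1.card ≤ (Fintype.card F : ℝ) ^ n :=
      pow_le_pow_right₀ (by linarith) (by simpa using Finset.card_le_univ y.2.1)
    have h2 : (Fintype.card F / 2 : ℝ) ^ M ≤ (Fintype.card F / 2 : ℝ) ^ y.2.2 :=
      pow_le_pow_right₀ (by linarith) hM
    gcongr
    exact h2.trans (le_mul_of_one_le_right (by positivity) (by linarith))

end Trials

/-! ### Dissemination -/

section Dissemination

variable {n : ℕ} {F : Type*} [Field F]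

theorem rlcState_eq_drive (mode : RLCMode) (w : ℕ → RLCSlot n F) (T : ℕ) :
    rlcState mode w T = drive (rlcStep mode) (fun i => {Pi.single i 1}) T fun t => w t := by
  induction T with
  | zero => rfl
  | succ T ih => rw [drive_succ, ← ih, rlcState]

/-- A node can decode all files as soon as no nonzero vector is orthogonal to all its packets. -/
theorem decodes_of_forall_dotProduct_ne_zero {S : Finset (Fin n → F)}
    (h : ∀ m : Fin n → F, m ≠ 0 → ∃ a ∈ S, dotProduct a m ≠ 0) (f : Fin n) : Decodes S f := by
  intro x y hxy
  by_contra hne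
  obtain ⟨a, ha, ham⟩ := h (x - y) fun h0 => hne (sub_eq_zero.1 (congrFun h0 f))
  refine ham ?_
  rw [dotProduct_sub, sub_eq_zero]
  exact hxy a ha

/-- The initial state of a dissemination, for a vector which does not vanish at `s`. -/
def initialTrialState (s : Fin n) : TrialState n F :=
  (fun i => {Pi.single i 1}, {s}, 0)

theorem drive_trialStep_fst (mode : RLCMode) (m : Fin n → F) (s : Fin n) (T : ℕ)
    (w : ℕ → RLCSlot n F) :
    (drive (trialStep mode m) (initialTrialState s) T fun t => w t).1 = rlcState mode w T := by
  induction T with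
  | zero => rfl
  | succ T ih => rw [drive_succ, rlcState, ← ih]; rfl

theorem drive_trialStep_snd_mem (mode : RLCMode) (m : Fin n → F) (s : Fin n) (T : ℕ)
    (w : ℕ → RLCSlot n F) :
    (drive (trialStep mode m) (initialTrialState s) T fun t => w t).2 ∈
      drive (branchStep mode) (singletonBranches n) T fun t => w t := by
  induction T with
  | zero => exact List.mem_map.2 ⟨s, by simp, rfl⟩
  | succ T ih =>
    rw [drive_succ, drive_succ]
    exact trialStep_mem_branchStep m (w T) ih

theorem valid_initialTrialState {m : Fin n → F} {s : Fin n} (hs : m s ≠ 0) :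
    (initialTrialState s).Valid m := by
  simp [TrialState.Valid, initialTrialState, hs]

variable [Fintype F] {Ω : Type*} [MeasurableSpace Ω] {μ : Measure Ω} [IsProbabilityMeasure μ]
  {Y : ℕ → Ω → RLCSlot n F}

/-- The union bound: decoding fails only if there are few trials for some pattern of successes, or
if many trials do not suffice for one of the at most `|F| ^ n` nonzero vectors. -/
theorem measureReal_not_decodes_le (hY : IsUniformSequence μ Y) (mode : RLCMode) (hn : 0 < n)
    (T M : ℕ) :
    μ.real {ω | ¬ ∀ i f, Decodes (rlcState mode (fun t => Y t ω) T i) f} ≤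
      (3 / 4) ^ T * n / (1 / 4) ^ M +
        (Fintype.card F : ℝ) ^ n * ((Fintype.card F : ℝ) ^ n * (2 / Fintype.card F) ^ M) := by
  classical
  have hs (m : Fin n → F) (hm : m ≠ 0) : ∃ s, m s ≠ 0 := Function.ne_iff.1 hm
  have : Nonempty (Fin n) := ⟨⟨0, hn⟩⟩
  choose! s hs using hs
  set few := {ω | ∃ p ∈ drive (branchStep mode) (singletonBranches n) T fun t => Y t ω,
    p.1 ≠ ∅ ∧ p.1 ≠ Finset.univ ∧ p.2 < M}
  set fail := fun m : Fin n → F =>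
    {ω | (drive (trialStep mode m) (initialTrialState (s m)) T fun t => Y t ω).2.1 ≠ Finset.univ ∧
      M ≤ (drive (trialStep mode m) (initialTrialState (s m)) T fun t => Y t ω).2.2}
  set I := Finset.univ.filter fun m : Fin n → F => m ≠ 0
  have hsub : {ω | ¬ ∀ i f, Decodes (rlcState mode (fun t => Y t ω) T i) f} ⊆
      few ∪ ⋃ m ∈ I, fail m := by
    intro ω
    contrapose!
    simp only [Set.mem_union, Set.mem_iUnion, not_or, not_exists, Set.mem_ofPred_eq, not_not]
    rintro ⟨hfew, hfail⟩ i
    refine decodes_of_forall_dotProduct_ne_zero fun m hm => ?_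
    have hvalid := drive_induction (valid_initialTrialState (hs m hm))
      (fun w _ h => TrialState.Valid.trialStep (mode := mode) w h) T fun t => Y t ω
    have hmem := drive_trialStep_snd_mem mode m (s m) T fun t => Y t ω
    have huniv : (drive (trialStep mode m) (initialTrialState (s m)) T fun t => Y t ω).2.1 =
        Finset.univ := by
      by_contra hne
      refine hfail m (by simp [I, hm]) ⟨hne, ?_⟩
      by_contra! hM
      exact hfew ⟨_, hmem, hvalid.1.ne_empty, hne, hM⟩
    have h := hvalid.2 i (huniv ▸ Finset.mem_univ i)
    rwa [drive_trialStep_fst mode m (s m) T fun t => Y t ω] at h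
  have hI : (I.card : ℝ) ≤ (Fintype.card F : ℝ) ^ n := by
    have h := Finset.card_le_univ I
    simp only [Fintype.card_fun, Fintype.card_fin] at h
    exact_mod_cast h
  calc μ.real _ ≤ μ.real (few ∪ ⋃ m ∈ I, fail m) := measureReal_mono hsub
    _ ≤ μ.real few + ∑ m ∈ I, μ.real (fail m) :=
      (measureReal_union_le _ _).trans (by gcongr; exact measureReal_biUnion_finset_le _ _)
    _ ≤ (3 / 4) ^ T * n / (1 / 4) ^ M +
        ∑ m ∈ I, (Fintype.card F : ℝ) ^ n * (2 / Fintype.card F) ^ M := by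
      refine add_le_add (measureReal_few_trials_le hY mode T M)
        (Finset.sum_le_sum fun m hm => ?_)
      exact measureReal_trials_fail_le hY mode
        (valid_initialTrialState (hs m (by simpa [I] using hm))) (by simp [initialTrialState])
        (by simp [initialTrialState]) T M
    _ ≤ _ := by
      rw [Finset.sum_const, nsmul_eq_mul]
      gcongr

/-- After `30 n` slots, with `4 n` trials in the union bound. -/
theorem measureReal_not_decodes_le_div (hY : IsUniformSequence μ Y) (mode : RLCMode)
    (hn : 2 ≤ n) (hF : n ≤ Fintype.card F) :
    μ.real {ω | ¬ ∀ i f, Decodes (rlcState mode (fun t => Y t ω) (30 * n) i) f} ≤ 8 / n := by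
  have hn0 : (0 : ℝ) < n := by positivity
  -- For `n < 8` the bound exceeds one; for `n ≥ 8` the estimates below need `q ≥ 8`.
  rcases lt_or_ge n 8 with h8 | h8
  · refine measureReal_le_one.trans ?_
    rw [one_le_div hn0]
    exact_mod_cast h8.le
  have hq : (8 : ℝ) ≤ Fintype.card F := by exact_mod_cast h8.trans hF
  have hnp : (n : ℝ) ≤ 2 ^ n := by exact_mod_cast n.lt_two_pow_self.le
  have h1 : (3 / 4 : ℝ) ^ (30 * n) * n / (1 / 4) ^ (4 * n) ≤ 1 / n := by
    -- The number 30 of slots per node comes from here: `(3 / 4) ^ 30 * 4 ^ 4 ≤ 1 / 4`.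
    have hpow : (3 / 4 : ℝ) ^ (30 * n) / (1 / 4) ^ (4 * n) ≤ (1 / 4) ^ n := by
      rw [pow_mul, pow_mul, ← div_pow]
      exact pow_le_pow_left₀ (by positivity) (by norm_num) n
    have h4 : (1 / 4 : ℝ) ^ n = 1 / (2 ^ n * 2 ^ n) := by
      rw [← mul_pow, one_div, inv_pow, one_div]
      norm_num
    calc _ = (3 / 4 : ℝ) ^ (30 * n) / (1 / 4) ^ (4 * n) * n := by ring
      _ ≤ (1 / 4) ^ n * n := by gcongr
      _ ≤ 1 / n := by
        rw [h4, one_div_mul_eq_div, div_le_div_iff₀ (by positivity) hn0, one_mul]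
        gcongr
  have h2 : (Fintype.card F : ℝ) ^ n *
      ((Fintype.card F : ℝ) ^ n * (2 / Fintype.card F) ^ (4 * n)) ≤ 1 / n := by
    set q : ℝ := (Fintype.card F : ℝ)
    have hq0 : 0 < q := by linarith
    calc q ^ n * (q ^ n * (2 / q) ^ (4 * n)) = (16 / q ^ 2) ^ n := by
          rw [pow_mul, ← mul_pow, ← mul_pow]
          congr 1
          field_simp
          norm_num
      _ ≤ (1 / 2) ^ n := by
          refine pow_le_pow_left₀ (by positivity) ?_ n
          rw [div_le_div_iff₀ (by positivity) (by norm_num)]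
          nlinarith
      _ ≤ 1 / n := by
          rw [one_div_pow]
          exact one_div_le_one_div_of_le hn0 hnp
  calc _ ≤ 1 / (n : ℝ) + 1 / n := 
        (measureReal_not_decodes_le hY mode (by lia) _ (4 * n)).trans (add_le_add h1 h2)
    _ ≤ 8 / n := by
      rw [← add_div]
      gcongr
      norm_num

end Dissemination

/-! ### Version age -/

section Age

variable {n : ℕ} {F : Type*} [Field F]

open scoped Classical in
/-- The recursion for a bound `d` on the version age at the beginning of a cycle of `L` slots with
the choices `g`: the age grows by at most `L` in the cycle, and what it was before is lost if the
node decodes all files. -/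
noncomputable def ageBoundStep (mode : RLCMode) (L : ℕ) (i : Fin n) (g : Fin L → RLCSlot n F)
    (d : ℕ) : ℕ :=
  L + if ∀ f, Decodes (drive (rlcStep mode) (fun i => {Pi.single i 1}) L g i) f then 0 else d

section Path

variable {mode : RLCMode} {L : ℕ} {w : ℕ → RLCSlot n F} {v : Fin n → ℕ → ℕ}

theorem version_le_add {v : ℕ → ℕ} (hv : ∀ t, v (t + 1) ≤ v t + 1) (s d : ℕ) :
    v (s + d) ≤ v s + d := by
  induction d with
  | zero => rfl
  | succ d ih => exact (hv _).trans (by lia)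

theorem versionAtCycle_mem_Icc (hmono : ∀ f, Monotone (v f)) (i f : Fin n) (k : ℕ) :
    versionAtCycle mode L w v i f k ∈ Set.Icc (v f 0) (v f (k * L)) := by
  induction k with
  | zero => simp [versionAtCycle]
  | succ k ih =>
    have h : v f (k * L) ≤ v f ((k + 1) * L) := hmono f (Nat.mul_le_mul_right L k.le_succ)
    unfold versionAtCycle
    split_ifs
    · exact ⟨hmono f (Nat.zero_le _), h⟩
    · exact ⟨ih.1, ih.2.trans h⟩

theorem versionAt_mem_Icc (hmono : ∀ f, Monotone (v f)) (i f : Fin n) (t : ℕ) :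
    versionAt mode L w v i f t ∈ Set.Icc (v f 0) (v f t) := by
  have h : v f (t / L * L) ≤ v f t := hmono f (Nat.div_mul_le_self t L)
  unfold versionAt
  split_ifs
  · exact ⟨hmono f (Nat.zero_le _), le_rfl⟩
  · exact ⟨hmono f (Nat.zero_le _), h⟩
  · exact ⟨(versionAtCycle_mem_Icc hmono i f _).1, (versionAtCycle_mem_Icc hmono i f _).2.trans h⟩

theorem version_le_versionAtCycle_add (hv : ∀ f t, v f (t + 1) ≤ v f t + 1) (i f : Fin n)
    (k : ℕ) :
    v f (k * L) ≤ versionAtCycle mode L w v i f k +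
      drive (ageBoundStep mode L i) 0 k fun a s => w (a * L + s) := by
  induction k with
  | zero => simp [versionAtCycle]
  | succ k ih =>
    rw [drive_succ (ageBoundStep mode L i) 0 k fun a (s : Fin L) => w (a * L + s)]
    have h := version_le_add (hv f) (k * L) L
    rw [← Nat.succ_mul] at h
    rw [versionAtCycle, ageBoundStep, rlcState_eq_drive mode fun s => w (k * L + s)]
    by_cases hall : ∀ f, Decodes (drive (rlcStep mode) (fun i => {Pi.single i 1}) L
        (fun s => w (k * L + s)) i) f
    · simp only [hall, if_true, implies_true]
      exact h
    · simp only [hall, if_false]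
      split_ifs <;> lia

theorem version_le_versionAt_add (hv : ∀ f t, v f (t + 1) ≤ v f t + 1)
    (hL : 0 < L) (i f : Fin n) (t : ℕ) :
    v f t ≤ versionAt mode L w v i f t +
      (L + drive (ageBoundStep mode L i) 0 (t / L) fun a s => w (a * L + s)) := by
  have h := version_le_add (hv f) (t / L * L) (t % L)
  rw [Nat.div_add_mod' t L] at h
  have hmod := Nat.mod_lt t hL
  have hcycle := version_le_versionAtCycle_add (mode := mode) (L := L) (w := w) hv i f (t / L)
  unfold versionAt
  split_ifs <;> lia

end Path

variable [Fintype F] {Ω : Type*} [MeasurableSpace Ω] {μ : Measure Ω} [IsProbabilityMeasure μ]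
  {ξ : ℕ → ∀ i : Fin n, Ω → RLCChoice n F i}

theorem IsRLCRandomness.measurableSet_decodes (hξ : IsRLCRandomness μ ξ) (mode : RLCMode)
    (a T : ℕ) (i f : Fin n) :
    MeasurableSet {ω | Decodes (rlcState mode (fun s j => ξ (a + s) j ω) T i) f} := by
  have h := (hξ.shift a).isUniformSequence.measurableSet_comp T fun g =>
    Decodes (drive (rlcStep mode) (fun i => {Pi.single i 1}) T g i) f
  simpa only [rlcState_eq_drive] using h

theorem measurable_versionAtCycle (hξ : IsRLCRandomness μ ξ) (mode : RLCMode) (L : ℕ)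
    {N : Fin n → ℕ → Ω → ℕ} (hN : IsUpdateProcess N) (i f : Fin n) (k : ℕ) :
    Measurable fun ω =>
      versionAtCycle mode L (fun s j => ξ s j ω) (fun g s => N g s ω) i f k := by
  induction k with
  | zero => exact hN.measurable f 0
  | succ k ih =>
    exact Measurable.ite (hξ.measurableSet_decodes mode (k * L) L i f) (hN.measurable f _) ih

theorem measurable_versionAt (hξ : IsRLCRandomness μ ξ) (mode : RLCMode) (L : ℕ)
    {N : Fin n → ℕ → Ω → ℕ} (hN : IsUpdateProcess N) (i f : Fin n) (t : ℕ) :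
    Measurable fun ω =>
      versionAt mode L (fun s j => ξ s j ω) (fun g s => N g s ω) i f t := by
  unfold versionAt
  by_cases h : i = f
  · simpa only [h, if_true] using hN.measurable f t
  · simp only [h, if_false]
    exact Measurable.ite (hξ.measurableSet_decodes mode (t / L * L) (t % L) i f)
      (hN.measurable f _) (measurable_versionAtCycle hξ mode L hN i f _)

theorem integrable_versionAge (hξ : IsRLCRandomness μ ξ) (mode : RLCMode) (L : ℕ)
    {N : Fin n → ℕ → Ω → ℕ} (hN : IsUpdateProcess N) (i f : Fin n) (t : ℕ) :
    Integrable (fun ω =>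
      versionAge mode L (fun s j => ξ s j ω) (fun g s => N g s ω) i f t) μ := by
  have hmeas : Measurable fun ω =>
      versionAge mode L (fun s j => ξ s j ω) (fun g s => N g s ω) i f t :=
    (measurable_from_top.comp (hN.measurable f t)).sub
      (measurable_from_top.comp (measurable_versionAt hξ mode L hN i f t))
  refine .of_bound hmeas.aestronglyMeasurable t (.of_forall fun ω => ?_)
  have h := versionAt_mem_Icc (mode := mode) (L := L) (w := fun s j => ξ s j ω)
    (v := fun g s => N g s ω) (fun f => monotone_nat_of_le_succ fun t => hN.mono f t ω) i f t
  have ht := version_le_add (v := fun s => N f s ω) (fun t => hN.le_add_one f t ω) 0 t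
  rw [zero_add] at ht
  have h1 : ((N f t ω : ℕ) : ℝ) ≤ N f 0 ω + t := by exact_mod_cast ht
  have h2 : ((N f 0 ω : ℕ) : ℝ) ≤ versionAt mode L (fun s j => ξ s j ω)
    (fun g s => N g s ω) i f t := by exact_mod_cast h.1
  have h3 : (versionAt mode L (fun s j => ξ s j ω) (fun g s => N g s ω) i f t : ℝ) ≤ N f t ω := by
    exact_mod_cast h.2
  rw [versionAge, Real.norm_of_nonneg (by linarith)]
  linarith

/-- If a node decodes all files in a cycle with probability at least `1 / 2`, then the bound on the
age at the beginning of a cycle has expectation at most `2 L`, a fixed point of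
`d ↦ L + d / 2`. -/
theorem integral_ageBound_sub_le (hξ : IsRLCRandomness μ ξ) (mode : RLCMode) (L : ℕ) (i : Fin n)
    (hfail : μ.real {ω | ¬ ∀ f, Decodes (rlcState mode (fun s j => ξ s j ω) L i) f} ≤ 1 / 2)
    (k : ℕ) :
    ∫ ω, ((drive (ageBoundStep mode L i) 0 k fun a s j => ξ (a * L + s) j ω : ℕ) : ℝ) - 2 * L ∂μ
      ≤ 0 := by
  classical
  have hY := hξ.isUniformSequence
  have hcount : ∑ g : Fin L → RLCSlot n F, (if ¬ ∀ f, Decodes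
      (drive (rlcStep mode) (fun i => {Pi.single i 1}) L g i) f then (1 : ℝ) else 0) ≤
      Fintype.card (Fin L → RLCSlot n F) * (1 / 2) := by
    simp only [rlcState_eq_drive] at hfail
    rw [hY.measureReal_eq_sum L fun g => ¬ ∀ f, Decodes
      (drive (rlcStep mode) (fun i => {Pi.single i 1}) L g i) f,
      div_le_iff₀' (pow_pos hY.card_pos L)] at hfail
    simpa only [Fintype.card_fun, Fintype.card_fin, Nat.cast_pow] using hfail
  have h := (hξ.isUniformSequence_cycle L).integral_drive_le (step := ageBoundStep mode L i)
    (x := 0) (p := fun _ => True) trivial (fun _ _ _ => trivial)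
    (φ := fun d : ℕ => (d : ℝ) - 2 * L) (r := 1 / 2) (by norm_num) (fun d _ => ?_) k
  · refine h.trans (mul_nonpos_of_nonneg_of_nonpos (by positivity) ?_)
    simp
  · have hstep (g : Fin L → RLCSlot n F) : ((ageBoundStep mode L i g d : ℕ) : ℝ) - 2 * L =
        -L + d * if ¬ ∀ f, Decodes
          (drive (rlcStep mode) (fun i => {Pi.single i 1}) L g i) f then (1 : ℝ) else 0 := by
      unfold ageBoundStep
      split_ifs <;> simp <;> ring
    simp only [hstep, Finset.sum_add_distrib, ← Finset.mul_sum, Finset.sum_const, nsmul_eq_mul,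
      Finset.card_univ]
    have := mul_le_mul_of_nonneg_left hcount (Nat.cast_nonneg (α := ℝ) d)
    linarith

theorem integral_versionAge_le (hξ : IsRLCRandomness μ ξ) (mode : RLCMode) {L : ℕ} (hL : 0 < L)
    {N : Fin n → ℕ → Ω → ℕ} (hN : IsUpdateProcess N) (i f : Fin n)
    (hfail : μ.real {ω | ¬ ∀ f, Decodes (rlcState mode (fun s j => ξ s j ω) L i) f} ≤ 1 / 2)
    (t : ℕ) :
    ∫ ω, versionAge mode L (fun s j => ξ s j ω) (fun g s => N g s ω) i f t ∂μ ≤ 3 * L := by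
  have hint : Integrable (fun ω => ((drive (ageBoundStep mode L i) 0 (t / L)
      fun a s j => ξ (a * L + s) j ω : ℕ) : ℝ) - 2 * L) μ :=
    (hξ.isUniformSequence_cycle L).integrable_comp (t / L) fun g =>
      ((drive (ageBoundStep mode L i) 0 (t / L) g : ℕ) : ℝ) - 2 * L
  calc _ ≤ ∫ ω, 3 * (L : ℝ) + (((drive (ageBoundStep mode L i) 0 (t / L)
        fun a s j => ξ (a * L + s) j ω : ℕ) : ℝ) - 2 * L) ∂μ := by
        refine integral_mono (integrable_versionAge hξ mode L hN i f t)
          ((integrable_const _).add hint) fun ω => ?_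
        have h := version_le_versionAt_add (mode := mode) (w := fun s j => ξ s j ω)
          (v := fun g s => N g s ω) (fun f t => hN.le_add_one f t ω) hL i f t
        have h' : (N f t ω : ℝ) ≤ versionAt mode L (fun s j => ξ s j ω)
            (fun g s => N g s ω) i f t + (L + (drive (ageBoundStep mode L i) 0 (t / L)
              fun a s j => ξ (a * L + s) j ω : ℕ)) := by exact_mod_cast h
        simp only [versionAge]
        linarith
    _ ≤ 3 * L := by
        rw [integral_add (integrable_const _) hint, integral_const]
        have := integral_ageBound_sub_le hξ mode L i hfail (t / L)
        simp only [probReal_univ, one_smul]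
        linarith

end Age

/-! ### The three bounds -/

theorem one_sub_le_measureReal_decodes {n : ℕ} {F : Type*} [Field F] [Fintype F] {Ω : Type*}
    [MeasurableSpace Ω] {μ : Measure Ω} [IsProbabilityMeasure μ]
    {ξ : ℕ → ∀ i : Fin n, Ω → RLCChoice n F i} (hξ : IsRLCRandomness μ ξ) (mode : RLCMode)
    (hn : 2 ≤ n) (hF : n ≤ Fintype.card F) :
    1 - 8 / n ≤
      μ.real {ω | ∀ i f, Decodes (rlcState mode (fun s j => ξ s j ω) (30 * n) i) f} := by
  have hmeas := hξ.isUniformSequence.measurableSet_comp (30 * n) fun g => ∀ i f, Decodes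
    (drive (rlcStep mode) (fun i => {Pi.single i 1}) (30 * n) g i) f
  have h := measureReal_not_decodes_le_div hξ.isUniformSequence mode hn hF
  simp only [rlcState_eq_drive] at h ⊢
  have hc := probReal_compl_eq_one_sub (μ := μ) hmeas
  rw [Set.compl_ofPred] at hc
  linarith

theorem mainTheorem4 (mode : RLCMode) :
    ∃ c : ℕ, 1 ≤ c ∧
      (∃ K : ℝ, ∀ (n : ℕ), 2 ≤ n →
        ∀ (F : Type u) [Field F] [Fintype F], n ≤ Fintype.card F →
        ∀ (Ω : Type v) [MeasurableSpace Ω] (μ : Measure Ω) [IsProbabilityMeasure μ]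
          (ξ : ℕ → ∀ i : Fin n, Ω → RLCChoice n F i), IsRLCRandomness μ ξ →
          1 - K / n ≤
            μ.real {ω | ∀ i f, Decodes (rlcState mode (fun s j => ξ s j ω) (c * n) i) f}) ∧
      (∃ p : ℝ, 0 ≤ p ∧ p < 1 ∧ ∃ n₀ : ℕ, ∀ (n : ℕ), n₀ < n →
        ∀ (F : Type u) [Field F] [Fintype F], n ≤ Fintype.card F →
        ∀ (Ω : Type v) [MeasurableSpace Ω] (μ : Measure Ω) [IsProbabilityMeasure μ]
          (ξ : ℕ → ∀ i : Fin n, Ω → RLCChoice n F i), IsRLCRandomness μ ξ →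
          ∀ i : Fin n,
            1 - p < μ.real {ω | ∀ f, Decodes (rlcState mode (fun s j => ξ s j ω) (c * n) i) f}) ∧
      (∃ A : ℝ, ∃ n₀ : ℕ, ∀ (n : ℕ), n₀ < n →
        ∀ (F : Type u) [Field F] [Fintype F], n ≤ Fintype.card F →
        ∀ (Ω : Type v) [MeasurableSpace Ω] (μ : Measure Ω) [IsProbabilityMeasure μ]
          (ξ : ℕ → ∀ i : Fin n, Ω → RLCChoice n F i), IsRLCRandomness μ ξ →
        ∀ N : Fin n → ℕ → Ω → ℕ, IsUpdateProcess N →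
        ∀ (i f : Fin n) (t : ℕ),
          Integrable (fun ω => versionAge mode (c * n) (fun s j => ξ s j ω)
            (fun g s => N g s ω) i f t) μ ∧
          ∫ ω, versionAge mode (c * n) (fun s j => ξ s j ω) (fun g s => N g s ω) i f t ∂μ
            ≤ A * n) := by
  refine ⟨30, by norm_num, ⟨8, ?_⟩, ⟨1 / 2, by norm_num, by norm_num, 16, ?_⟩, 3 * 30, 16, ?_⟩
  · intro n hn F _ _ hF Ω _ μ _ ξ hξ
    exact one_sub_le_measureReal_decodes hξ mode hn hF
  · intro n hn F _ _ hF Ω _ μ _ ξ hξ i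
    have hn' : (16 : ℝ) < n := by exact_mod_cast hn
    have h8 : (8 : ℝ) / n < 1 / 2 := by
      rw [div_lt_div_iff₀ (by linarith) (by norm_num)]
      linarith
    have h := one_sub_le_measureReal_decodes hξ mode (by lia) hF
    have hmono : μ.real {ω | ∀ i f, Decodes (rlcState mode (fun s j => ξ s j ω) (30 * n) i) f} ≤
        μ.real {ω | ∀ f, Decodes (rlcState mode (fun s j => ξ s j ω) (30 * n) i) f} :=
      measureReal_mono fun ω hω => hω i
    linarith
  · intro n hn F _ _ hF Ω _ μ _ ξ hξ N hN i f t
    have hn' : (16 : ℝ) < n := by exact_mod_cast hn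
    have h8 : (8 : ℝ) / n ≤ 1 / 2 := by
      rw [div_le_div_iff₀ (by linarith) (by norm_num)]
      linarith
    have hfail : μ.real {ω | ¬ ∀ f, Decodes
        (rlcState mode (fun s j => ξ s j ω) (30 * n) i) f} ≤ 1 / 2 := by
      refine le_trans (measureReal_mono ?_)
        ((measureReal_not_decodes_le_div hξ.isUniformSequence mode (by lia) hF).trans h8)
      exact fun ω hω hall => hω (hall i)
    refine ⟨integrable_versionAge hξ mode (30 * n) hN i f t, ?_⟩
    refine (integral_versionAge_le hξ mode (by lia) hN i f hfail t).trans_eq ?_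
    push_cast
    ring
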